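/- Let $\mathcal H$ be a complex Hilbert space and let $\mathcal B(\mathcal H)$ be the algebra of bounded linear operators on $\mathcal H$. For $T\in\mathcal B(\mathcal H)$ let $\|T\|$ be the operator norm, let $w(T)=\sup\{|\langle Tx,x\rangle| : x\in\mathcal H,\ \|x\|=1\}$ be the numerical radius, let $|T|=(T^*T)^{1/2}$, and for $s\ge 0$ let $|T|^s$ be defined by the continuous functional calculus, with $|T|^0=I$. Then for all $A,B,C,D\in\mathcal B(\mathcal H)$ and for both choices of the sign, $$ w(AB\pm CD)\le \frac14\Big(\inf_{t\in[0,1]}\big\||A|^{2t}+|B^*|^{2(1-t)}\big\|\,\big\||A^*|^{2(1-t)}+|B|^{2t}\big\| + \inf_{t\in[0,1]}\big\||C|^{2t}+|D^*|^{2(1-t)}\big\|\,\big\||C^*|^{2(1-t)}+|D|^{2t}\big\|\Big). $$ -/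

import Mathlib

noncomputable section

/-- The numerical radius `w(T) = sup {|⟨T x, x⟩| : ‖x‖ = 1}` of a bounded operator. -/
def numericalRadius {H : Type*} [NormedAddCommGroup H] [InnerProductSpace ℂ H]
    (T : H →L[ℂ] H) : ℝ :=
  sSup {r : ℝ | ∃ x : H, ‖x‖ = 1 ∧ r = ‖inner ℂ (T x) x‖}

/-- The power `|T|^s` of the modulus `|T| = (T* T)^{1/2}`, by continuous functional calculus;
`|T|^0` is the identity. -/
def absPow {H : Type*} [NormedAddCommGroup H] [InnerProductSpace ℂ H] [CompleteSpace H]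
    (T : H →L[ℂ] H) (s : ℝ) : H →L[ℂ] H :=
  CFC.abs T ^ s

/-- `inf_{0 ≤ t ≤ 1} ‖|S|^{2t} + |T*|^{2(1-t)}‖ ‖|S*|^{2(1-t)} + |T|^{2t}‖`. -/
def mixedInf {H : Type*} [NormedAddCommGroup H] [InnerProductSpace ℂ H] [CompleteSpace H]
    (S T : H →L[ℂ] H) : ℝ :=
  ⨅ t : Set.Icc (0 : ℝ) 1,
    ‖absPow S (2 * (t : ℝ)) + absPow (star T) (2 * (1 - (t : ℝ)))‖ *
      ‖absPow (star S) (2 * (1 - (t : ℝ))) + absPow T (2 * (t : ℝ))‖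

end

open Filter Topology

section CStarAlgebra

variable {𝒜 : Type*} [CStarAlgebra 𝒜]

/-! Fix `t` and put `R = |A*|^(1-t)`, `P = |A|^t`, `Q = |B*|^(1-t)`, `S = |B|^t`. Approximate polar
decomposition (`CFC.exists_contraction_norm_sub_le`) makes `A` and `B` limits of `R K P` and `Q L S`
with contractions `K`, `L`, so `|⟨ABx, x⟩| ≤ ‖PQ‖ ‖Sx‖ ‖Rx‖`. Two arithmetic–geometric means, `‖PQ‖
≤ ‖P² + Q²‖ / 2` (`norm_mul_le_half_norm_add`) and `‖Rx‖ ‖Sx‖ ≤ ‖R² + S²‖ / 2`, give the factor 1/4.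
The bound holds for each product separately, so each gets its own infimum over `t`. -/

/-- An element intertwining `a` and `b` intertwines their polynomials. -/
theorem SemiconjBy.aeval_polynomial {x a b : 𝒜} (h : SemiconjBy x a b) (q : Polynomial ℝ) :
    SemiconjBy x (Polynomial.aeval a q) (Polynomial.aeval b q) := by
  induction q using Polynomial.induction_on' with
  | add p q hp hq => simpa using hp.add_right hq
  | monomial n r =>
    simp only [Polynomial.aeval_monomial]
    exact SemiconjBy.mul_right (Algebra.commutes r x).symm (h.pow_right n)

/-- An element intertwining two selfadjoint elements intertwines their continuous functions. -/
theorem SemiconjBy.cfc_real {x a b : 𝒜} (h : SemiconjBy x a b) (ha : IsSelfAdjoint a)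
    (hb : IsSelfAdjoint b) {f : ℝ → ℝ} (hf : Continuous f) :
    SemiconjBy x (cfc f a) (cfc f b) := by
  rcases subsingleton_or_nontrivial 𝒜 with _ | _
  · exact Subsingleton.elim _ _
  -- Both spectra lie in `[-M, M]`, so one polynomial approximates `f` for both elements.
  set M : ℝ := max ‖a‖ ‖b‖
  have near {c : 𝒜} (hc : IsSelfAdjoint c) (hcM : ‖c‖ ≤ M) {ε : ℝ} (hε : 0 < ε)
      {p : Polynomial ℝ} (hp : ∀ y ∈ Set.Icc (-M) M, |p.eval y - f y| < ε) :
      ‖Polynomial.aeval c p - cfc f c‖ ≤ ε := by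
    rw [← cfc_polynomial p c, ← cfc_sub p.eval f c p.continuous.continuousOn hf.continuousOn]
    refine norm_cfc_le hε.le fun y hy ↦ (hp y ?_).le
    exact abs_le.1 ((spectrum.norm_le_norm_of_mem hy).trans hcM)
  refine sub_eq_zero.1 (norm_le_zero_iff.1 (le_of_forall_pos_le_add fun ε hε ↦ ?_))
  set δ : ℝ := ε / (2 * ‖x‖ + 1)
  have hδ : 0 < δ := by positivity
  obtain ⟨p, hp⟩ := exists_polynomial_near_of_continuousOn (-M) M f hf.continuousOn δ hδ
  have hxa := near ha (le_max_left _ _) hδ hp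
  have hxb := near hb (le_max_right _ _) hδ hp
  have key : x * cfc f a - cfc f b * x =
      (Polynomial.aeval b p - cfc f b) * x - x * (Polynomial.aeval a p - cfc f a) := by
    rw [sub_mul, mul_sub, (h.aeval_polynomial p).eq]
    abel
  calc ‖x * cfc f a - cfc f b * x‖
      ≤ ‖Polynomial.aeval b p - cfc f b‖ * ‖x‖ + ‖x‖ * ‖Polynomial.aeval a p - cfc f a‖ := by
        rw [key]
        exact (norm_sub_le _ _).trans (add_le_add (norm_mul_le _ _) (norm_mul_le _ _))
    _ ≤ δ * ‖x‖ + ‖x‖ * δ := by gcongr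
    _ ≤ δ * (2 * ‖x‖ + 1) := by nlinarith
    _ = 0 + ε := by rw [zero_add]; exact div_mul_cancel₀ _ (by positivity)

variable [PartialOrder 𝒜] [StarOrderedRing 𝒜]

/-- Since `a (a* a) = (a a*) a`, the intertwining passes to square roots. -/
theorem CFC.semiconjBy_abs_abs_star (a : 𝒜) :
    SemiconjBy a (CFC.abs a) (CFC.abs (star a)) := by
  have h : SemiconjBy a (star a * a) (star (star a) * star a) := by
    simp [SemiconjBy, mul_assoc]
  have := h.cfc_real (IsSelfAdjoint.star_mul_self a) (IsSelfAdjoint.star_mul_self (star a))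
    Real.continuous_sqrt
  rwa [← cfcₙ_eq_cfc, ← cfcₙ_eq_cfc, ← CFC.sqrt_eq_real_sqrt _ (star_mul_self_nonneg _),
    ← CFC.sqrt_eq_real_sqrt _ (star_mul_self_nonneg _)] at this

theorem CFC.norm_abs_mul (a x : 𝒜) : ‖CFC.abs a * x‖ = ‖a * x‖ := by
  have h : star (CFC.abs a * x) * (CFC.abs a * x) = star (a * x) * (a * x) := by
    rw [star_mul, star_mul, (CFC.abs_nonneg a).isSelfAdjoint.star_eq, mul_assoc,
      ← mul_assoc (CFC.abs a), CFC.abs_mul_abs]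
    simp only [mul_assoc]
  refine (mul_self_inj_of_nonneg (norm_nonneg _) (norm_nonneg _)).1 ?_
  rw [← CStarRing.norm_star_mul_self, ← CStarRing.norm_star_mul_self, h]

/-- Invertibility is not needed: for nonnegative exponents the scalar law survives at 0, with `0 ^ 0
= 1`. -/
theorem CFC.rpow_add_of_nonneg {a : 𝒜} (ha : 0 ≤ a) {s t : ℝ} (hs : 0 ≤ s) (ht : 0 ≤ t) :
    a ^ (s + t) = a ^ s * a ^ t := by
  rw [CFC.rpow_eq_cfc_real ha, CFC.rpow_eq_cfc_real ha, CFC.rpow_eq_cfc_real ha,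
    ← cfc_mul _ _ a (Real.continuous_rpow_const hs).continuousOn
      (Real.continuous_rpow_const ht).continuousOn]
  exact cfc_congr fun x hx ↦ Real.rpow_add_of_nonneg (spectrum_nonneg_of_nonneg ha hx) hs ht

/-- Approximate polar decomposition: `a` is the limit of `|a*|^(1-t) k |a|^t` with contractions
`k`. -/
theorem CFC.exists_contraction_norm_sub_le (a : 𝒜) {t : ℝ} (ht0 : 0 ≤ t) (ht1 : t ≤ 1)
    {ε : ℝ} (hε : 0 < ε) :
    ∃ k : 𝒜, ‖k‖ ≤ 1 ∧ ‖CFC.abs (star a) ^ (1 - t) * k * CFC.abs a ^ t - a‖ ≤ ε := by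
  have hp : 0 ≤ CFC.abs a := CFC.abs_nonneg a
  have hq : 0 ≤ CFC.abs (star a) := CFC.abs_nonneg _
  have ht' : 0 ≤ 1 - t := sub_nonneg.2 ht1
  -- `a * g` regularises the partial isometry `a |a|⁻¹`; the absolute value makes the function
  -- continuous on all of `ℝ` and changes nothing on the spectrum.
  have hg : Continuous fun x : ℝ ↦ (|x| + ε)⁻¹ :=
    (continuous_abs.add continuous_const).inv₀ fun x ↦
      (add_pos_of_nonneg_of_pos (_root_.abs_nonneg x) hε).ne'
  set g : 𝒜 := cfc (fun x : ℝ ↦ (|x| + ε)⁻¹) (CFC.abs a)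
  have hpg : CFC.abs a * g = cfc (fun x : ℝ ↦ x * (|x| + ε)⁻¹) (CFC.abs a) := by
    rw [cfc_mul (fun x : ℝ ↦ x) _ _ continuousOn_id hg.continuousOn, cfc_id' ℝ (CFC.abs a)]
  refine ⟨a * g, ?_, ?_⟩
  · rw [← CFC.norm_abs_mul, hpg]
    refine norm_cfc_le zero_le_one fun x _ ↦ ?_
    rw [Real.norm_eq_abs, abs_mul, abs_of_pos (a := (|x| + ε)⁻¹) (by positivity),
      ← div_eq_mul_inv, div_le_one (by positivity)]
    linarith
  · have hsemi : SemiconjBy a (CFC.abs a ^ (1 - t)) (CFC.abs (star a) ^ (1 - t)) := by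
      rw [CFC.rpow_eq_cfc_real hp, CFC.rpow_eq_cfc_real hq]
      exact (CFC.semiconjBy_abs_abs_star a).cfc_real hp.isSelfAdjoint hq.isSelfAdjoint
        (Real.continuous_rpow_const ht')
    have hcomm : CFC.abs a ^ (1 - t) * g = g * CFC.abs a ^ (1 - t) := by
      rw [CFC.rpow_eq_cfc_real hp]
      exact cfc_commute_cfc _ _ _
    have hfac : CFC.abs (star a) ^ (1 - t) * (a * g) * CFC.abs a ^ t
        = a * (g * CFC.abs a) := by
      rw [← mul_assoc, ← hsemi.eq, mul_assoc a, hcomm, mul_assoc, mul_assoc,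
        ← CFC.rpow_add_of_nonneg hp ht' ht0, sub_add_cancel, CFC.rpow_one _ hp]
    have hgp : Continuous fun x : ℝ ↦ x * (|x| + ε)⁻¹ := continuous_id.mul hg
    have hgcomm : g * CFC.abs a = CFC.abs a * g := by
      have := cfc_commute_cfc (fun x : ℝ ↦ (|x| + ε)⁻¹) (fun x : ℝ ↦ x) (CFC.abs a)
      rw [cfc_id' ℝ (CFC.abs a)] at this
      exact this
    have hdiff : CFC.abs a * (g * CFC.abs a - 1) =
        cfc (fun x : ℝ ↦ x * (x * (|x| + ε)⁻¹ - 1)) (CFC.abs a) := by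
      rw [cfc_mul (fun x : ℝ ↦ x) (fun x : ℝ ↦ x * (|x| + ε)⁻¹ - 1) _ continuousOn_id
          (hgp.sub continuous_const).continuousOn, cfc_id' ℝ (CFC.abs a),
        cfc_sub (fun x : ℝ ↦ x * (|x| + ε)⁻¹) (fun _ ↦ 1) _ hgp.continuousOn continuousOn_const,
        ← hpg, hgcomm,
        cfc_const_one ℝ (CFC.abs a)]
    rw [hfac, ← mul_sub_one, ← CFC.norm_abs_mul, hdiff]
    refine norm_cfc_le hε.le fun x hx ↦ ?_
    have hx0 : 0 ≤ x := spectrum_nonneg_of_nonneg hp hx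
    have : x * (x * (|x| + ε)⁻¹ - 1) = -(ε * (x / (x + ε))) := by
      rw [_root_.abs_of_nonneg hx0]
      field_simp
      ring
    rw [this, norm_neg, Real.norm_of_nonneg (by positivity)]
    exact mul_le_of_le_one_right hε.le ((div_le_one (by positivity)).2 (by linarith))

end CStarAlgebra

section Operator

variable {H : Type*} [NormedAddCommGroup H] [InnerProductSpace ℂ H] [CompleteSpace H]

theorem IsSelfAdjoint.inner_apply_left {P : H →L[ℂ] H} (hP : IsSelfAdjoint P) (x y : H) :
    inner ℂ (P x) y = inner ℂ x (P y) := by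
  rw [← ContinuousLinearMap.adjoint_inner_right, ← ContinuousLinearMap.star_eq_adjoint, hP.star_eq]

theorem norm_sq_add_norm_sq_eq_inner {P Q : H →L[ℂ] H} (hP : IsSelfAdjoint P)
    (hQ : IsSelfAdjoint Q) (z : H) :
    ‖P z‖ ^ 2 + ‖Q z‖ ^ 2 = (inner ℂ ((P * P + Q * Q) z) z).re := by
  simp only [add_apply, mul_apply_eq_comp, inner_add_left,
    hP.inner_apply_left (P z), hQ.inner_apply_left (Q z), Complex.add_re]
  rw [inner_self_eq_norm_sq_to_K, inner_self_eq_norm_sq_to_K]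
  norm_cast

theorem norm_sq_add_norm_sq_le {P Q : H →L[ℂ] H} (hP : IsSelfAdjoint P)
    (hQ : IsSelfAdjoint Q) (z : H) :
    ‖P z‖ ^ 2 + ‖Q z‖ ^ 2 ≤ ‖P * P + Q * Q‖ * ‖z‖ ^ 2 := by
  rw [norm_sq_add_norm_sq_eq_inner hP hQ]
  calc (inner ℂ ((P * P + Q * Q) z) z).re ≤ ‖(P * P + Q * Q) z‖ * ‖z‖ :=
        re_inner_le_norm (𝕜 := ℂ) _ _
    _ ≤ ‖P * P + Q * Q‖ * ‖z‖ * ‖z‖ := by gcongr; exact ContinuousLinearMap.le_opNorm _ _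
    _ = _ := by ring

/-- The row `(P, Q)` is the adjoint of the column `z ↦ (P z, Q z)`, so it has the same norm. -/
theorem norm_apply_add_apply_sq_le {P Q : H →L[ℂ] H} (hP : IsSelfAdjoint P)
    (hQ : IsSelfAdjoint Q) (x y : H) :
    ‖P x + Q y‖ ^ 2 ≤ ‖P * P + Q * Q‖ * (‖x‖ ^ 2 + ‖y‖ ^ 2) := by
  set z := P x + Q y with hz
  set N := ‖P * P + Q * Q‖
  rcases (norm_nonneg z).eq_or_lt with h0 | h0
  · rw [← h0, zero_pow two_ne_zero]; positivity
  have h1 : ‖z‖ ^ 2 ≤ ‖x‖ * ‖P z‖ + ‖y‖ * ‖Q z‖ := by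
    have : ‖z‖ ^ 2 = (inner ℂ x (P z)).re + (inner ℂ y (Q z)).re := by
      rw [← hP.inner_apply_left, ← hQ.inner_apply_left, ← Complex.add_re, ← inner_add_left, ← hz,
        inner_self_eq_norm_sq_to_K]
      norm_cast
    rw [this]
    exact add_le_add (re_inner_le_norm (𝕜 := ℂ) _ _) (re_inner_le_norm (𝕜 := ℂ) _ _)
  have h2 := norm_sq_add_norm_sq_le hP hQ z
  have h3 : (‖z‖ ^ 2) ^ 2 ≤ (‖x‖ ^ 2 + ‖y‖ ^ 2) * (‖P z‖ ^ 2 + ‖Q z‖ ^ 2) :=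
    calc (‖z‖ ^ 2) ^ 2 ≤ (‖x‖ * ‖P z‖ + ‖y‖ * ‖Q z‖) ^ 2 := by gcongr
      _ ≤ _ := by nlinarith [sq_nonneg (‖x‖ * ‖Q z‖ - ‖y‖ * ‖P z‖)]
  have h4 : (‖z‖ ^ 2) * ‖z‖ ^ 2 ≤ (N * (‖x‖ ^ 2 + ‖y‖ ^ 2)) * ‖z‖ ^ 2 :=
    calc (‖z‖ ^ 2) * ‖z‖ ^ 2 = (‖z‖ ^ 2) ^ 2 := by ring
      _ ≤ _ := h3
      _ ≤ (‖x‖ ^ 2 + ‖y‖ ^ 2) * (N * ‖z‖ ^ 2) := by gcongr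
      _ = _ := by ring
  exact le_of_mul_le_mul_right h4 (by positivity)

/-- Operator arithmetic–geometric mean inequality for the norm. -/
theorem norm_mul_le_half_norm_add {P Q : H →L[ℂ] H} (hP : IsSelfAdjoint P)
    (hQ : IsSelfAdjoint Q) : ‖P * Q‖ ≤ ‖P * P + Q * Q‖ / 2 := by
  set N := ‖P * P + Q * Q‖
  have hre (x y : H) : (inner ℂ (P x) (Q y)).re ≤ N / 4 * (‖x‖ ^ 2 + ‖y‖ ^ 2) := by
    -- Polarization: `4 Re⟨u, v⟩ = ‖u + v‖² - ‖u - v‖²`, with the last term dropped.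
    have h1 := norm_add_sq (𝕜 := ℂ) (P x) (Q y)
    have h2 := norm_sub_sq (𝕜 := ℂ) (P x) (Q y)
    have h3 := norm_apply_add_apply_sq_le hP hQ x y
    have h4 := sq_nonneg ‖P x - Q y‖
    simp only [RCLike.re_to_complex] at h1 h2
    nlinarith
  refine ContinuousLinearMap.opNorm_le_bound _ (by positivity) fun y ↦ ?_
  rcases (norm_nonneg ((P * Q) y)).eq_or_lt with h0 | h0
  · rw [← h0]; positivity
  set w := (P * Q) y with hw
  -- Rescaling `w` to the length of `y` balances the two squares in `hre`.
  set x : H := ((‖y‖ / ‖w‖ : ℝ) : ℂ) • w with hx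
  have hnx : ‖x‖ = ‖y‖ := by
    rw [hx, norm_smul, Complex.norm_real, Real.norm_of_nonneg (by positivity)]
    exact div_mul_cancel₀ _ h0.ne'
  have hin : (inner ℂ (P x) (Q y)).re = ‖y‖ * ‖w‖ := by
    rw [hP.inner_apply_left, hx, inner_smul_left, ← mul_apply_eq_comp, ← hw,
      Complex.conj_ofReal, Complex.re_ofReal_mul, ← RCLike.re_to_complex, inner_self_eq_norm_sq]
    field_simp
  have h := hre x y
  rw [hin, hnx] at h
  rcases (norm_nonneg y).eq_or_lt with hy | hy
  · have : y = 0 := norm_eq_zero.1 hy.symm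
    simp [hw, this] at h0
  · refine le_of_mul_le_mul_left ?_ hy
    linarith

theorem absPow_isSelfAdjoint (T : H →L[ℂ] H) (s : ℝ) : IsSelfAdjoint (absPow T s) :=
  IsSelfAdjoint.of_nonneg CFC.rpow_nonneg

theorem absPow_mul_absPow (T : H →L[ℂ] H) {s : ℝ} (hs : 0 ≤ s) :
    absPow T s * absPow T s = absPow T (2 * s) := by
  rw [two_mul]
  exact (CFC.rpow_add_of_nonneg (CFC.abs_nonneg T) hs hs).symm

theorem exists_contraction_tendsto_absPow (T : H →L[ℂ] H) {t : ℝ} (ht0 : 0 ≤ t) (ht1 : t ≤ 1) :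
    ∃ K : ℕ → H →L[ℂ] H, (∀ n, ‖K n‖ ≤ 1) ∧
      Tendsto (fun n ↦ absPow (star T) (1 - t) * K n * absPow T t) atTop (𝓝 T) := by
  choose K hK1 hK using fun n : ℕ ↦
    CFC.exists_contraction_norm_sub_le T ht0 ht1 (Nat.one_div_pos_of_nat (α := ℝ) (n := n))
  refine ⟨K, hK1, tendsto_iff_norm_sub_tendsto_zero.2 ?_⟩
  exact squeeze_zero (fun _ ↦ norm_nonneg _) hK tendsto_one_div_add_atTop_nhds_zero_nat

theorem norm_inner_mul_apply_self_le (A B : H →L[ℂ] H) {t : ℝ} (ht0 : 0 ≤ t) (ht1 : t ≤ 1)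
    {x : H} (hx : ‖x‖ = 1) :
    ‖inner ℂ ((A * B) x) x‖ ≤ (1 / 4 : ℝ) *
      (‖absPow A (2 * t) + absPow (star B) (2 * (1 - t))‖ *
        ‖absPow (star A) (2 * (1 - t)) + absPow B (2 * t)‖) := by
  have ht' : 0 ≤ 1 - t := sub_nonneg.2 ht1
  simp only [← absPow_mul_absPow _ ht0, ← absPow_mul_absPow _ ht']
  obtain ⟨K, hK1, hK⟩ := exists_contraction_tendsto_absPow A ht0 ht1
  obtain ⟨L, hL1, hL⟩ := exists_contraction_tendsto_absPow B ht0 ht1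
  set P := absPow A t
  set Q := absPow (star B) (1 - t)
  set R := absPow (star A) (1 - t)
  set S := absPow B t
  have hP : IsSelfAdjoint P := absPow_isSelfAdjoint _ _
  have hQ : IsSelfAdjoint Q := absPow_isSelfAdjoint _ _
  have hR : IsSelfAdjoint R := absPow_isSelfAdjoint _ _
  have hS : IsSelfAdjoint S := absPow_isSelfAdjoint _ _
  have hcont : Continuous fun T : H →L[ℂ] H ↦ ‖(inner ℂ (T x) x : ℂ)‖ := by fun_prop
  refine le_of_tendsto ((hcont.tendsto _).comp (hK.mul hL)) (Eventually.of_forall fun n ↦ ?_)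
  have happ : ((R * K n * P) * (Q * L n * S)) x = R (K n ((P * Q) (L n (S x)))) := rfl
  have hRS := norm_sq_add_norm_sq_le hR hS x
  rw [hx, one_pow, mul_one] at hRS
  have hcontr {T : H →L[ℂ] H} (hT : ‖T‖ ≤ 1) (z : H) : ‖T z‖ ≤ ‖z‖ := by
    simpa using T.le_of_opNorm_le hT z
  calc ‖(inner ℂ (((R * K n * P) * (Q * L n * S)) x) x : ℂ)‖
      = ‖(inner ℂ (K n ((P * Q) (L n (S x)))) (R x) : ℂ)‖ := by rw [happ, hR.inner_apply_left]
    _ ≤ ‖K n ((P * Q) (L n (S x)))‖ * ‖R x‖ := norm_inner_le_norm _ _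
    _ ≤ (‖P * P + Q * Q‖ / 2 * ‖S x‖) * ‖R x‖ := by
        gcongr
        refine (hcontr (hK1 n) _).trans
          (((P * Q).le_of_opNorm_le (norm_mul_le_half_norm_add hP hQ) _).trans ?_)
        gcongr
        exact hcontr (hL1 n) _
    _ = ‖P * P + Q * Q‖ / 2 * (‖R x‖ * ‖S x‖) := by ring
    _ ≤ ‖P * P + Q * Q‖ / 2 * (‖R * R + S * S‖ / 2) := by
        gcongr
        nlinarith [sq_nonneg (‖R x‖ - ‖S x‖)]
    _ = _ := by ring

theorem norm_inner_mul_apply_self_le_mixedInf (A B : H →L[ℂ] H) {x : H} (hx : ‖x‖ = 1) :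
    ‖inner ℂ ((A * B) x) x‖ ≤ (1 / 4 : ℝ) * mixedInf A B := by
  rw [← div_le_iff₀' (by norm_num)]
  have : Nonempty (Set.Icc (0 : ℝ) 1) := ⟨⟨0, by simp⟩⟩
  refine le_ciInf fun t ↦ ?_
  rw [div_le_iff₀' (by norm_num)]
  exact norm_inner_mul_apply_self_le A B t.2.1 t.2.2 hx

theorem mixedInf_nonneg (A B : H →L[ℂ] H) : 0 ≤ mixedInf A B :=
  Real.iInf_nonneg fun _ ↦ by positivity

end Operator

theorem theorem2p15 {H : Type*} [NormedAddCommGroup H] [InnerProductSpace ℂ H] [CompleteSpace H]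
    (A B C D : H →L[ℂ] H) :
    numericalRadius (A * B + C * D) ≤ (1 / 4 : ℝ) * (mixedInf A B + mixedInf C D) ∧
    numericalRadius (A * B - C * D) ≤ (1 / 4 : ℝ) * (mixedInf A B + mixedInf C D) := by
  -- Needed when `H` is trivial: there are no unit vectors and `sSup ∅ = 0`.
  have hnonneg : 0 ≤ (1 / 4 : ℝ) * (mixedInf A B + mixedInf C D) :=
    mul_nonneg (by norm_num) (add_nonneg (mixedInf_nonneg A B) (mixedInf_nonneg C D))
  constructor
  all_goals
    refine Real.sSup_le ?_ hnonneg
    rintro r ⟨x, hx, rfl⟩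
    have h1 := norm_inner_mul_apply_self_le_mixedInf A B hx
    have h2 := norm_inner_mul_apply_self_le_mixedInf C D hx
    rw [mul_add]
  · rw [add_apply, inner_add_left]
    exact (norm_add_le _ _).trans (add_le_add h1 h2)
  · rw [sub_apply, inner_sub_left]
    exact (norm_sub_le _ _).trans (add_le_add h1 h2)
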